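/- Consider planar systems $\dot x=P(x,y)$, $\dot y=Q(x,y)$ with real polynomials $P,Q$. A point $p$ with $P(p)=Q(p)=0$ is a *center* if it has a neighborhood $U$ such that every point of $U\setminus\{p\}$ lies on a (nonconstant) periodic orbit. All coefficients $a_{ij}$, $b_{ij}$, $p_i$ below are arbitrary real numbers (in particular, $P$ and $Q$ may be coprime, but this is not required). "No centers" means that no point of $\mathbb R^2$ is a center. The following statements hold. **(a)** (Weight degree 1.) The system $\dot x=a_{10}x+a_{01}y$, $\dot y=b_{10}x+b_{01}y$ has a center at the origin if and only if $b_{01}=-a_{10}$ and $a_{10}b_{01}-a_{01}b_{10}>0$. The system $\dot x=a_{10}x$, $\dot y=b_{p0}x^p+b_{01}y$, with $p\in\mathbb N$, $p>1$, has no centers. **(b)** (Weight degree 2.) The systems - $\dot x=a_{20}x^2+a_{11}xy+a_{02}y^2$, $\dot y=b_{20}x^2+b_{11}xy+b_{02}y^2$, - $\dot x=a_{01}y$, $\dot y=b_{20}x^2$ have no centers. The system $\dot x=a_{20}x^2+a_{01}y$, $\dot y=b_{30}x^3+b_{11}xy$ has a center at the origin if and only if $a_{01}b_{30}\neq0$ and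 $(2a_{20}+b_{11})^2+8(b_{30}a_{01}-b_{11}a_{20})<0$. **(c)** (Weight degree 3.) The systems - $\dot x=a_{30}x^3+a_{11}xy$, $\dot y=b_{40}x^4+b_{21}x^2y+b_{02}y^2$, - $\dot x=p_1x^3+p_2x^2y+p_3xy^2+\mu y^3$, $\dot y=\mu x^3+p_1x^2y+p_2xy^2+p_3y^3$, with $\mu\neq0$, - $\dot x=p_1x^3+(p_2+3\alpha)x^2y+(p_3-6\alpha)xy^2-6\alpha y^3$, $\dot y=p_1x^2y+(p_2-3\alpha)xy^2+(p_3+6\alpha)y^3$, with $\alpha=\pm1$, - $\dot x=p_1x^3+p_2x^2y+(p_3+2)xy^2-4y^3$, $\dot y=p_1x^2y+p_2xy^2+(p_3-2)y^3$, - $\dot x=p_1x^3+(p_2-3\alpha)x^2y+p_3xy^2-6y^3$, $\dot y=p_1x^2y+(p_2+3\alpha)xy^2+p_3y^3$, with $\alpha=\pm1$, - $\dot x=p_1x^3+p_2x^2y+p_3xy^2-\alpha y^3$, $\dot y=p_1x^2y+p_2xy^2+p_3y^3$, with $\alpha=\pm1$, - $\dot x=x(p_1x^2+p_2xy+p_3y^2)$,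 $\dot y=y(p_1x^2+p_2xy+p_3y^2)$ have no centers. The system $\dot x=a_{30}x^3+a_{01}y$, $\dot y=b_{50}x^5+b_{21}x^2y$ has a center at the origin if and only if $a_{01}b_{50}\neq0$, $(3a_{30}+b_{21})^2+12(b_{50}a_{01}-b_{21}a_{30})<0$ and $3a_{30}+b_{21}=0$. Each of the systems - $\dot x=p_1x^3+(p_2-3\alpha\mu)x^2y+p_3xy^2-\alpha y^3$, $\dot y=\alpha x^3+p_1x^2y+(p_2+3\alpha\mu)xy^2+p_3y^3$, with $\alpha=\pm1$, $\mu>-\frac13$ and $\mu\neq\frac13$, - $\dot x=p_1x^3+(p_2-\alpha)x^2y+p_3xy^2-\alpha y^3$, $\dot y=\alpha x^3+p_1x^2y+(p_2+\alpha)xy^2+p_3y^3$, with $\alpha=\pm1$ has a center if and only if $p_3=-p_1$, and a center of such a system can only be the origin. **(d)** (Weight degree 4.) The systems - $\dot x=a_{40}x^4+a_{31}x^3y+a_{22}x^2y^2+a_{13}xy^3+a_{04}y^4$, $\dot y=b_{40}x^4+b_{31}x^3y+b_{22}x^2y^2+b_{13}xy^3+b_{04}y^4$, - $\dot x=a_{40}x^4+a_{21}x^2y+a_{02}y^2$,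 $\dot y=b_{50}x^5+b_{31}x^3y+b_{12}xy^2$, - $\dot x=a_{40}x^4+a_{11}xy$, $\dot y=b_{60}x^6+b_{31}x^3y+b_{02}y^2$, - $\dot x=a_{11}xy$, $\dot y=b_{30}x^3+b_{02}y^2$, - $\dot x=a_{01}y$, $\dot y=b_{40}x^4$ have no centers. The system $\dot x=a_{40}x^4+a_{01}y$, $\dot y=b_{70}x^7+b_{31}x^3y$ has a center at the origin if and only if $a_{01}b_{70}\neq0$ and $(4a_{40}+b_{31})^2+16(b_{70}a_{01}-b_{31}a_{40})<0$. -/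

import Mathlib

/-- `γ` is a solution, defined for all times, of the planar differential system
`x' = P(x, y)`, `y' = Q(x, y)`. -/
def IsSolution (P Q : ℝ → ℝ → ℝ) (γ : ℝ → ℝ × ℝ) : Prop :=
  ∀ t : ℝ, HasDerivAt γ (P (γ t).1 (γ t).2, Q (γ t).1 (γ t).2) t

/-- The point `q` lies on a periodic orbit of the system `x' = P(x, y)`, `y' = Q(x, y)`:
the solution through `q` is periodic and not constant. -/
def OnPeriodicOrbit (P Q : ℝ → ℝ → ℝ) (q : ℝ × ℝ) : Prop :=
  ∃ (γ : ℝ → ℝ × ℝ) (T : ℝ), 0 < T ∧ IsSolution P Q γ ∧ γ 0 = q ∧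
    Function.Periodic γ T ∧ ∃ t : ℝ, γ t ≠ q

/-- The point `p` is a center of the system `x' = P(x, y)`, `y' = Q(x, y)`: it is a singular
point, and it has a neighborhood `U` such that every point of `U` other than `p` lies on a
periodic orbit. (The union of `{p}` and of the periodic orbits that meet `U` is then a
neighborhood of `p` that consists of `p` and of whole periodic orbits.) -/
def IsCenter (P Q : ℝ → ℝ → ℝ) (p : ℝ × ℝ) : Prop :=
  P p.1 p.2 = 0 ∧ Q p.1 p.2 = 0 ∧
    ∃ U ∈ nhds p, ∀ q ∈ U, q ≠ p → OnPeriodicOrbit P Q q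

/-- The system `x' = P(x, y)`, `y' = Q(x, y)` has no centers, at the origin or elsewhere. -/
def HasNoCenters (P Q : ℝ → ℝ → ℝ) : Prop :=
  ∀ p : ℝ × ℝ, ¬ IsCenter P Q p

open Set Filter Topology

/-! ### Uniqueness and reparametrization of solutions -/

/-- Two global solutions of `w' = m(t) • V(w)`, with `V` of class `C¹` and `m` continuous, that
agree at one time are equal. -/
theorem eq_of_hasDerivAt_smul {V : ℝ × ℝ → ℝ × ℝ} (hV : ContDiff ℝ 1 V) {m : ℝ → ℝ}
    (hm : Continuous m) {f g : ℝ → ℝ × ℝ} (hf : ∀ t, HasDerivAt f (m t • V (f t)) t)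
    (hg : ∀ t, HasDerivAt g (m t • V (g t)) t) {t₀ : ℝ} (h₀ : f t₀ = g t₀) : f = g := by
  have hfc : Continuous f := continuous_iff_continuousAt.2 fun t => (hf t).continuousAt
  have hgc : Continuous g := continuous_iff_continuousAt.2 fun t => (hg t).continuousAt
  funext t
  obtain ⟨A, B, ht, ht₀⟩ : ∃ A B, t ∈ Ioo A B ∧ t₀ ∈ Ioo A B :=
    ⟨min t t₀ - 1, max t t₀ + 1,
      ⟨by linarith [min_le_left t t₀], by linarith [le_max_left t t₀]⟩,
      ⟨by linarith [min_le_right t t₀], by linarith [le_max_right t t₀]⟩⟩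
  set S : Set (ℝ × ℝ) := f '' Icc A B ∪ g '' Icc A B with hS
  have hSc : IsCompact S := (isCompact_Icc.image hfc).union (isCompact_Icc.image hgc)
  obtain ⟨K, hK⟩ := (hV.locallyLipschitz.locallyLipschitzOn
    (s := S)).exists_lipschitzOnWith_of_compact hSc
  obtain ⟨M, hM⟩ := isCompact_Icc.exists_bound_of_continuousOn (hm.continuousOn (s := Icc A B))
  have hv : ∀ s ∈ Ioo A B, LipschitzOnWith (M.toNNReal * K) (fun w => m s • V w) S := by
    intro s hs
    refine LipschitzOnWith.of_dist_le_mul fun x hx y hy => ?_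
    rw [dist_smul₀, NNReal.coe_mul, mul_assoc]
    exact mul_le_mul ((hM s (Ioo_subset_Icc_self hs)).trans (Real.le_coe_toNNReal M))
      (hK.dist_le_mul x hx y hy) dist_nonneg (NNReal.coe_nonneg _)
  exact ODE_solution_unique_of_mem_Ioo hv ht₀
    (fun s hs => ⟨hf s, Or.inl ⟨s, Ioo_subset_Icc_self hs, rfl⟩⟩)
    (fun s hs => ⟨hg s, Or.inr ⟨s, Ioo_subset_Icc_self hs, rfl⟩⟩) h₀ ht

/-- The primitive of a continuous function has that function as its derivative. -/
theorem hasDerivAt_primitive {m : ℝ → ℝ} (hm : Continuous m) (a t : ℝ) :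
    HasDerivAt (fun s => ∫ u in a..s, m u) (m t) t :=
  intervalIntegral.integral_hasDerivAt_right (hm.intervalIntegrable _ _)
    (hm.stronglyMeasurableAtFilter _ _) hm.continuousAt

section PlanarSystem

variable {P Q : ℝ → ℝ → ℝ}

/-- A periodic orbit contains no singular point. -/
theorem not_isSingular_of_periodic (hV : ContDiff ℝ 1 fun q : ℝ × ℝ => (P q.1 q.2, Q q.1 q.2))
    {γ : ℝ → ℝ × ℝ} (hγ : IsSolution P Q γ) (hne : ∃ t, γ t ≠ γ 0) (t₀ : ℝ) :
    ¬ (P (γ t₀).1 (γ t₀).2 = 0 ∧ Q (γ t₀).1 (γ t₀).2 = 0) := by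
  rintro ⟨hP, hQ⟩
  have h : γ = fun _ => γ t₀ := by
    refine eq_of_hasDerivAt_smul hV (m := fun _ => 1) continuous_const
      (fun t => by simpa using hγ t) (fun t => ?_) (t₀ := t₀) rfl
    rw [hP, hQ, show ((0 : ℝ), (0 : ℝ)) = 0 from rfl, smul_zero]
    exact hasDerivAt_const t (γ t₀)
  obtain ⟨t, ht⟩ := hne
  exact ht ((congrFun h t).trans (congrFun h 0).symm)

theorem not_onPeriodicOrbit_of_singular
    (hV : ContDiff ℝ 1 fun q : ℝ × ℝ => (P q.1 q.2, Q q.1 q.2)) {q : ℝ × ℝ}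
    (hP : P q.1 q.2 = 0) (hQ : Q q.1 q.2 = 0) : ¬ OnPeriodicOrbit P Q q := by
  rintro ⟨γ, T, -, hγ, rfl, -, hne⟩
  exact not_isSingular_of_periodic hV hγ hne 0 ⟨hP, hQ⟩

/-- A curve tangent to the vector field that accumulates at a singular point does not meet
any periodic orbit. -/
theorem not_onPeriodicOrbit_of_mem_closure
    (hV : ContDiff ℝ 1 fun q : ℝ × ℝ => (P q.1 q.2, Q q.1 q.2)) {p : ℝ × ℝ}
    (hP : P p.1 p.2 = 0) (hQ : Q p.1 p.2 = 0) {c : ℝ → ℝ × ℝ} {m : ℝ → ℝ} (hm : Continuous m)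
    (hc : ∀ t, HasDerivAt c (m t • (P (c t).1 (c t).2, Q (c t).1 (c t).2)) t)
    (hp : p ∈ closure (range c)) (t₀ : ℝ) : ¬ OnPeriodicOrbit P Q (c t₀) := by
  rintro ⟨γ, T, hT, hγ, hγ0, hper, hne⟩
  have hγc : Continuous γ := continuous_iff_continuousAt.2 fun t => (hγ t).continuousAt
  have hcγ : c = fun t => γ (∫ u in t₀..t, m u) :=
    eq_of_hasDerivAt_smul hV hm hc
      (fun t => (hγ _).scomp t (hasDerivAt_primitive hm t₀ t)) (t₀ := t₀) (by simp [hγ0])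
  have hsub : range c ⊆ range γ := by
    rw [hcγ]
    rintro _ ⟨t, rfl⟩
    exact mem_range_self _
  have hclosed : IsClosed (range γ) := (hper.compact_of_continuous hT.ne' hγc).isClosed
  obtain ⟨t, rfl⟩ := closure_minimal hsub hclosed hp
  exact not_isSingular_of_periodic hV hγ (by rwa [hγ0]) t ⟨hP, hQ⟩

/-- A singular point at which a curve tangent to the vector field accumulates, without passing
through it, is not a center. -/
theorem not_isCenter_of_mem_closure
    (hV : ContDiff ℝ 1 fun q : ℝ × ℝ => (P q.1 q.2, Q q.1 q.2)) {p : ℝ × ℝ}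
    {c : ℝ → ℝ × ℝ} {m : ℝ → ℝ} (hm : Continuous m)
    (hc : ∀ t, HasDerivAt c (m t • (P (c t).1 (c t).2, Q (c t).1 (c t).2)) t)
    (hp : p ∈ closure (range c)) (hne : ∀ t, c t ≠ p) : ¬ IsCenter P Q p := by
  rintro ⟨hP, hQ, U, hU, h⟩
  obtain ⟨_, hx, t, rfl⟩ := mem_closure_iff_nhds.1 hp U hU
  exact not_onPeriodicOrbit_of_mem_closure hV hP hQ hm hc hp t (h _ hx (hne t))

/-- A singular point that is a limit of other singular points is not a center. -/
theorem not_isCenter_of_tendsto_singular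
    (hV : ContDiff ℝ 1 fun q : ℝ × ℝ => (P q.1 q.2, Q q.1 q.2)) {p : ℝ × ℝ}
    {ι : Type*} {l : Filter ι} [l.NeBot] {c : ι → ℝ × ℝ} (hc : Tendsto c l (𝓝 p))
    (hne : ∀ᶠ i in l, c i ≠ p)
    (hs : ∀ i, P (c i).1 (c i).2 = 0 ∧ Q (c i).1 (c i).2 = 0) : ¬ IsCenter P Q p := by
  rintro ⟨-, -, U, hU, h⟩
  obtain ⟨i, hi, hi'⟩ := ((hc.eventually_mem hU).and hne).exists
  exact not_onPeriodicOrbit_of_singular hV (hs i).1 (hs i).2 (h _ hi hi')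

/-- A closed curve that is tangent to the vector field, with a positive speed factor, is a
periodic orbit. -/
theorem onPeriodicOrbit_of_closed_curve_of_pos {c : ℝ → ℝ × ℝ} {m : ℝ → ℝ} {L : ℝ} (hL : 0 < L)
    (hm : Continuous m) (hmpos : ∀ t, 0 < m t)
    (hc : ∀ t, HasDerivAt c (m t • (P (c t).1 (c t).2, Q (c t).1 (c t).2)) t)
    (hcp : Function.Periodic c L) (hmp : Function.Periodic m L) {t₀ : ℝ}
    (hne : ∃ t, c t ≠ c t₀) : OnPeriodicOrbit P Q (c t₀) := by
  set τ : ℝ → ℝ := fun t => ∫ u in (0 : ℝ)..t, m u with hτ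
  have hτd : ∀ t, HasDerivAt τ (m t) t := hasDerivAt_primitive hm 0
  have hτc : Continuous τ := continuous_iff_continuousAt.2 fun t => (hτd t).continuousAt
  have hmi : ∀ a b, IntervalIntegrable m MeasureTheory.volume a b := fun a b =>
    hm.intervalIntegrable a b
  have hτmono : StrictMono τ := strictMono_of_hasDerivAt_pos hτd hmpos
  have hτsurj : Function.Surjective τ := hτc.surjective
    (hmp.tendsto_atTop_intervalIntegral_of_pos' (hmi 0 L) hmpos hL)
    (hmp.tendsto_atBot_intervalIntegral_of_pos' (hmi 0 L) hmpos hL)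
  set σ := (hτmono.orderIsoOfSurjective τ hτsurj).symm with hσ
  have hτσ : ∀ s, τ (σ s) = s := fun s =>
    (hτmono.orderIsoOfSurjective τ hτsurj).apply_symm_apply s
  have hσc : Continuous σ := σ.continuous
  have hσd : ∀ s, HasDerivAt σ (m (σ s))⁻¹ s := fun s =>
    HasDerivAt.of_local_left_inverse hσc.continuousAt (hτd (σ s)) (hmpos _).ne'
      (Eventually.of_forall hτσ)
  have hτL : ∀ t, τ (t + L) = τ t + τ L := fun t => by
    simpa [hτ] using hmp.intervalIntegral_add_eq_add 0 t hmi
  have hσL : ∀ s, σ (s + τ L) = σ s + L := fun s =>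
    hτmono.injective (by rw [hτσ, hτL, hτσ])
  refine ⟨fun s => c (σ (s + τ t₀)), τ L, ?_, fun s => ?_, ?_, fun s => ?_, ?_⟩
  · have := hτmono hL
    simpa [hτ] using this
  · have h1 : HasDerivAt (fun s => σ (s + τ t₀)) (m (σ (s + τ t₀)))⁻¹ s :=
      (hσd (s + τ t₀)).comp_add_const s (τ t₀)
    have h2 := (hc (σ (s + τ t₀))).scomp s h1
    rwa [smul_smul, inv_mul_cancel₀ (hmpos _).ne', one_smul] at h2
  · have : σ (τ t₀) = t₀ := hτmono.injective (hτσ _)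
    simp [this]
  · have : s + τ L + τ t₀ = (s + τ t₀) + τ L := by ring
    simp only [this, hσL, hcp _]
  · obtain ⟨t, ht⟩ := hne
    refine ⟨τ t - τ t₀, ?_⟩
    have : σ (τ t) = t := hτmono.injective (hτσ _)
    simpa [this] using ht

/-- A closed curve that is tangent to the vector field, with a nonvanishing speed factor, is a
periodic orbit. -/
theorem onPeriodicOrbit_of_closed_curve {c : ℝ → ℝ × ℝ} {m : ℝ → ℝ} {L : ℝ} (hL : 0 < L)
    (hm : Continuous m) (hm0 : ∀ t, m t ≠ 0)
    (hc : ∀ t, HasDerivAt c (m t • (P (c t).1 (c t).2, Q (c t).1 (c t).2)) t)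
    (hcp : Function.Periodic c L) (hmp : Function.Periodic m L) {t₀ : ℝ}
    (hne : ∃ t, c t ≠ c t₀) : OnPeriodicOrbit P Q (c t₀) := by
  by_cases hpos : ∀ t, 0 < m t
  · exact onPeriodicOrbit_of_closed_curve_of_pos hL hm hpos hc hcp hmp hne
  · obtain ⟨a, ha⟩ := not_forall.1 hpos
    have hneg : ∀ t, m t < 0 := by
      intro t
      by_contra ht
      obtain ⟨s, hs⟩ := mem_range_of_exists_le_of_exists_ge hm ⟨a, not_lt.1 ha⟩ ⟨t, not_lt.1 ht⟩
      exact hm0 s hs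
    have := onPeriodicOrbit_of_closed_curve_of_pos (P := P) (Q := Q) (c := fun t => c (-t))
      (m := fun t => -m (-t)) (t₀ := -t₀) hL (hm.comp continuous_neg).neg
      (fun t => neg_pos.2 (hneg _))
      (fun t => by
        have := (hc (-t)).scomp t (hasDerivAt_neg t)
        rwa [smul_smul, neg_one_mul] at this)
      (fun t => by simpa only [neg_add] using hcp.neg (-t))
      (fun t => by simpa only [neg_add] using congrArg Neg.neg (hmp.neg (-t)))
      (by
        obtain ⟨t, ht⟩ := hne
        exact ⟨-t, by simpa using ht⟩)
    simpa using this

end PlanarSystem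

/-! ### Quasi-homogeneous systems -/

/-- The system `x' = P(x, y)`, `y' = Q(x, y)` is quasi-homogeneous, with positive weight exponents
`s₁`, `s₂` and weight degree `e + 1`, and of class `C¹`. -/
structure IsQuasiHomogeneous (s₁ s₂ e : ℕ) (P Q : ℝ → ℝ → ℝ) : Prop where
  contDiff : ContDiff ℝ 1 fun q : ℝ × ℝ => (P q.1 q.2, Q q.1 q.2)
  pos_left : 0 < s₁
  pos_right : 0 < s₂
  map_fst : ∀ l x y : ℝ, P (l ^ s₁ * x) (l ^ s₂ * y) = l ^ (s₁ + e) * P x y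
  map_snd : ∀ l x y : ℝ, Q (l ^ s₁ * x) (l ^ s₂ * y) = l ^ (s₂ + e) * Q x y

/-- A point of the unit circle is of the form `(cos θ, sin θ)`. -/
theorem exists_cos_sin_eq {x y : ℝ} (h : x ^ 2 + y ^ 2 = 1) :
    ∃ θ : ℝ, Real.cos θ = x ∧ Real.sin θ = y := by
  have hn : ‖(⟨x, y⟩ : ℂ)‖ = 1 := by
    rw [Complex.norm_eq_sqrt_sq_add_sq, h, Real.sqrt_one]
  have h0 : (⟨x, y⟩ : ℂ) ≠ 0 := norm_ne_zero_iff.1 (by rw [hn]; exact one_ne_zero)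
  exact ⟨Complex.arg ⟨x, y⟩, by rw [Complex.cos_arg h0, hn, div_one],
    by rw [Complex.sin_arg, hn, div_one]⟩

/-- Weighted polar coordinates. -/
theorem exists_weighted_polar {s₁ s₂ : ℕ} (h₁ : 0 < s₁) (h₂ : 0 < s₂) {q : ℝ × ℝ}
    (hq : q ≠ (0, 0)) : ∃ b θ : ℝ,
      q = (Real.exp b ^ s₁ * Real.cos θ, Real.exp b ^ s₂ * Real.sin θ) := by
  obtain ⟨x, y⟩ := q
  set f : ℝ → ℝ := fun l => (l ^ s₁ * x) ^ 2 + (l ^ s₂ * y) ^ 2 with hf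
  have hfc : Continuous f := by fun_prop
  have hxy : 0 < x ^ 2 + y ^ 2 := by
    by_contra hle
    refine hq (Prod.ext ?_ ?_)
    · exact pow_eq_zero_iff two_ne_zero |>.1 (by nlinarith [sq_nonneg x, sq_nonneg y])
    · exact pow_eq_zero_iff two_ne_zero |>.1 (by nlinarith [sq_nonneg x, sq_nonneg y])
  set M : ℝ := 1 + (x ^ 2 + y ^ 2)⁻¹ with hM
  have hi : 0 < (x ^ 2 + y ^ 2)⁻¹ := inv_pos.2 hxy
  have hM1 : 1 ≤ M := by linarith
  have hfM : 1 ≤ f M := by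
    have e1 : M * x ^ 2 ≤ (M ^ s₁ * x) ^ 2 := by
      rw [mul_pow, ← pow_mul]
      exact mul_le_mul_of_nonneg_right (le_self_pow₀ hM1 (by positivity)) (sq_nonneg x)
    have e2 : M * y ^ 2 ≤ (M ^ s₂ * y) ^ 2 := by
      rw [mul_pow, ← pow_mul]
      exact mul_le_mul_of_nonneg_right (le_self_pow₀ hM1 (by positivity)) (sq_nonneg y)
    have e3 : M * (x ^ 2 + y ^ 2) = (x ^ 2 + y ^ 2) + 1 := by
      rw [hM, add_mul, inv_mul_cancel₀ hxy.ne', one_mul]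
    simp only [hf]
    linarith
  have hf0 : f 0 = 0 := by simp [hf, h₁.ne', h₂.ne']
  obtain ⟨l, ⟨hl0, -⟩, hl⟩ := intermediate_value_Icc (by linarith : (0 : ℝ) ≤ M)
    hfc.continuousOn (show (1 : ℝ) ∈ Icc (f 0) (f M) from ⟨by rw [hf0]; exact zero_le_one, hfM⟩)
  have hlpos : 0 < l := by
    refine lt_of_le_of_ne hl0 fun h => ?_
    rw [← h, hf0] at hl
    exact zero_ne_one hl
  obtain ⟨θ, hθ, hθ'⟩ := exists_cos_sin_eq hl
  refine ⟨-Real.log l, θ, ?_⟩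
  rw [Real.exp_neg, Real.exp_log hlpos, hθ, hθ', ← mul_assoc, ← mul_assoc, ← mul_pow, ← mul_pow,
    inv_mul_cancel₀ hlpos.ne', one_pow, one_pow, one_mul, one_mul]

/-- The derivative of a curve in weighted polar coordinates. -/
theorem hasDerivAt_exp_pow_mul {B f : ℝ → ℝ} {B' f' t : ℝ} (s : ℕ) (hB : HasDerivAt B B' t)
    (hf : HasDerivAt f f' t) :
    HasDerivAt (fun t => Real.exp (B t) ^ s * f t)
      (Real.exp (B t) ^ s * (s * B' * f t + f')) t := by
  have h : HasDerivAt (fun t => Real.exp (s * B t) * f t)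
      (Real.exp (s * B t) * (s * B') * f t + Real.exp (s * B t) * f') t :=
    ((hB.const_mul (s : ℝ)).exp).mul hf
  simp only [Real.exp_nat_mul] at h
  convert h using 1
  ring

theorem tendsto_exp_pow_mul {ι : Type*} {l : Filter ι} {B f : ι → ℝ} {s : ℕ} (hs : 0 < s)
    (hB : Tendsto B l atBot) (hf : ∀ i, |f i| ≤ 1) (a : ℝ) :
    Tendsto (fun i => Real.exp (B i) ^ s * (a * f i)) l (𝓝 0) := by
  have h1 : Tendsto (fun i => Real.exp (B i) ^ s) l (𝓝 0) := by
    simpa [hs.ne'] using (Real.tendsto_exp_atBot.comp hB).pow s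
  refine h1.zero_mul_isBoundedUnder_le ⟨|a|, eventually_map.2 (Eventually.of_forall fun i => ?_)⟩
  simp only [Function.comp_apply, Real.norm_eq_abs, abs_mul]
  exact mul_le_of_le_one_right (abs_nonneg a) (hf i)

namespace IsQuasiHomogeneous

variable {s₁ s₂ e : ℕ} {P Q : ℝ → ℝ → ℝ}

theorem apply_zero_fst (h : IsQuasiHomogeneous s₁ s₂ e P Q) : P 0 0 = 0 := by
  have h1 := h.map_fst 0 0 0
  simpa [h.pos_left.ne'] using h1

theorem apply_zero_snd (h : IsQuasiHomogeneous s₁ s₂ e P Q) : Q 0 0 = 0 := by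
  have h1 := h.map_snd 0 0 0
  simpa [h.pos_right.ne'] using h1

theorem singular_smul (h : IsQuasiHomogeneous s₁ s₂ e P Q) {q : ℝ × ℝ}
    (hP : P q.1 q.2 = 0) (hQ : Q q.1 q.2 = 0) (l : ℝ) :
    P (l ^ s₁ * q.1) (l ^ s₂ * q.2) = 0 ∧ Q (l ^ s₁ * q.1) (l ^ s₂ * q.2) = 0 := by
  rw [h.map_fst, h.map_snd, hP, hQ, mul_zero, mul_zero]
  exact ⟨rfl, rfl⟩

/-- A center of a quasi-homogeneous system is the origin. -/
theorem eq_zero_of_isCenter (h : IsQuasiHomogeneous s₁ s₂ e P Q) {p : ℝ × ℝ}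
    (hp : IsCenter P Q p) : p = (0, 0) := by
  by_contra hne
  refine not_isCenter_of_tendsto_singular h.contDiff (l := 𝓝[>] (1 : ℝ))
    (c := fun l => (l ^ s₁ * p.1, l ^ s₂ * p.2)) ?_ ?_
    (fun l => h.singular_smul hp.1 hp.2.1 l) hp
  · have : Continuous fun l : ℝ => (l ^ s₁ * p.1, l ^ s₂ * p.2) := by fun_prop
    have h1 := this.tendsto 1
    simp only [one_pow, one_mul, Prod.mk.eta] at h1
    exact h1.mono_left nhdsWithin_le_nhds
  · filter_upwards [self_mem_nhdsWithin] with l hl heq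
    have hl : 1 < l := hl
    have hx : l ^ s₁ * p.1 = p.1 := congrArg Prod.fst heq
    have hy : l ^ s₂ * p.2 = p.2 := congrArg Prod.snd heq
    have k₁ := one_lt_pow₀ hl h.pos_left.ne'
    have k₂ := one_lt_pow₀ hl h.pos_right.ne'
    refine hne (Prod.ext ?_ ?_)
    · exact (mul_eq_zero.1 (show (l ^ s₁ - 1) * p.1 = 0 by linarith)).resolve_left (by linarith)
    · exact (mul_eq_zero.1 (show (l ^ s₂ - 1) * p.2 = 0 by linarith)).resolve_left (by linarith)

/-- If the vector field is tangent to a weighted ray from the origin, the origin is not a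
center. -/
theorem not_isCenter_of_ray (h : IsQuasiHomogeneous s₁ s₂ e P Q) {x y : ℝ}
    (hxy : (x, y) ≠ ((0, 0) : ℝ × ℝ)) (h0 : s₁ * x * Q x y = s₂ * y * P x y) :
    ¬ IsCenter P Q (0, 0) := by
  have hs₁ : (0 : ℝ) < s₁ := Nat.cast_pos.2 h.pos_left
  have hs₂ : (0 : ℝ) < s₂ := Nat.cast_pos.2 h.pos_right
  obtain ⟨k, hkP, hkQ⟩ : ∃ k : ℝ, P x y = k * (s₁ * x) ∧ Q x y = k * (s₂ * y) := by
    by_cases hx : x = 0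
    · have hy : y ≠ 0 := fun hy => hxy (by rw [hx, hy])
      refine ⟨Q x y / (s₂ * y), ?_, by field_simp⟩
      have : s₂ * y * P x y = 0 := by rw [← h0, hx]; ring
      rw [(mul_eq_zero.1 this).resolve_left (mul_ne_zero hs₂.ne' hy), hx]
      ring
    · refine ⟨P x y / (s₁ * x), by field_simp, ?_⟩
      field_simp
      linarith
  set c : ℝ → ℝ × ℝ := fun t => (Real.exp (-t) ^ s₁ * x, Real.exp (-t) ^ s₂ * y) with hc
  have hc0 : Tendsto c atTop (𝓝 (0, 0)) := by
    refine Tendsto.prodMk_nhds ?_ ?_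
    · simpa using tendsto_exp_pow_mul (f := fun _ => 1) h.pos_left tendsto_neg_atTop_atBot
        (fun _ => by simp) x
    · simpa using tendsto_exp_pow_mul (f := fun _ => 1) h.pos_right tendsto_neg_atTop_atBot
        (fun _ => by simp) y
  have hcne : ∀ t, c t ≠ (0, 0) := by
    intro t ht
    have hx : Real.exp (-t) ^ s₁ * x = 0 := congrArg Prod.fst ht
    have hy : Real.exp (-t) ^ s₂ * y = 0 := congrArg Prod.snd ht
    exact hxy (Prod.ext ((mul_eq_zero.1 hx).resolve_left (by positivity))
      ((mul_eq_zero.1 hy).resolve_left (by positivity)))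
  by_cases hk : k = 0
  · exact not_isCenter_of_tendsto_singular h.contDiff hc0 (Eventually.of_forall hcne)
      fun t => h.singular_smul (q := (x, y)) (by simp [hkP, hk]) (by simp [hkQ, hk]) _
  · refine not_isCenter_of_mem_closure h.contDiff (c := c)
      (m := fun t => -(k * Real.exp (-t) ^ e)⁻¹) ?_ (fun t => ?_)
      (mem_closure_of_tendsto hc0 (Eventually.of_forall fun t => mem_range_self t)) hcne
    · exact (Continuous.inv₀ (by fun_prop) fun t => by positivity).neg
    · have d1 := hasDerivAt_exp_pow_mul s₁ (hasDerivAt_neg t) (hasDerivAt_const t x)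
      have d2 := hasDerivAt_exp_pow_mul s₂ (hasDerivAt_neg t) (hasDerivAt_const t y)
      have hE : Real.exp (-t) ≠ 0 := (Real.exp_pos _).ne'
      refine (d1.prodMk d2).congr_deriv (Prod.ext ?_ ?_)
      · simp only [hc, Prod.smul_mk, smul_eq_mul, h.map_fst, hkP, pow_add]
        field_simp
        ring
      · simp only [hc, Prod.smul_mk, smul_eq_mul, h.map_snd, hkQ, pow_add]
        field_simp
        ring

theorem hasNoCenters_of_ray (h : IsQuasiHomogeneous s₁ s₂ e P Q) {x y : ℝ}
    (hxy : (x, y) ≠ ((0, 0) : ℝ × ℝ)) (h0 : s₁ * x * Q x y = s₂ * y * P x y) :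
    HasNoCenters P Q := by
  intro p hp
  have := h.eq_zero_of_isCenter hp
  subst this
  exact h.not_isCenter_of_ray hxy h0 hp

/-- If `s₁ x Q - s₂ y P` takes opposite values at two antipodal points of the unit
circle, the system has no centers. -/
theorem hasNoCenters_of_antipodal (h : IsQuasiHomogeneous s₁ s₂ e P Q) (α : ℝ)
    (h0 : s₁ * -Real.cos α * Q (-Real.cos α) (-Real.sin α)
        - s₂ * -Real.sin α * P (-Real.cos α) (-Real.sin α)
      = -(s₁ * Real.cos α * Q (Real.cos α) (Real.sin α)
        - s₂ * Real.sin α * P (Real.cos α) (Real.sin α))) :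
    HasNoCenters P Q := by
  have hP : Continuous fun q : ℝ × ℝ => P q.1 q.2 := h.contDiff.continuous.fst
  have hQ : Continuous fun q : ℝ × ℝ => Q q.1 q.2 := h.contDiff.continuous.snd
  set f : ℝ → ℝ := fun t => s₁ * Real.cos t * Q (Real.cos t) (Real.sin t)
    - s₂ * Real.sin t * P (Real.cos t) (Real.sin t) with hf
  have hcs : Continuous fun t : ℝ => (Real.cos t, Real.sin t) := by fun_prop
  have hfc : Continuous f :=
    ((continuous_const.mul Real.continuous_cos).mul (hQ.comp hcs)).sub
      ((continuous_const.mul Real.continuous_sin).mul (hP.comp hcs))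
  have hfa : f (α + Real.pi) = -f α := by
    simp only [hf, Real.cos_add_pi, Real.sin_add_pi]
    exact h0
  obtain ⟨t, ht⟩ : ∃ t, f t = 0 := by
    rcases le_total (f α) 0 with hle | hle
    · exact mem_range_of_exists_le_of_exists_ge hfc ⟨α, hle⟩ ⟨α + Real.pi, by linarith⟩
    · exact mem_range_of_exists_le_of_exists_ge hfc ⟨α + Real.pi, by linarith⟩ ⟨α, hle⟩
  refine h.hasNoCenters_of_ray (x := Real.cos t) (y := Real.sin t) (fun heq => ?_)
    (sub_eq_zero.1 ht)
  have hx : Real.cos t = 0 := congrArg Prod.fst heq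
  have hy : Real.sin t = 0 := congrArg Prod.snd heq
  have := Real.cos_sq_add_sin_sq t
  rw [hx, hy] at this
  norm_num at this

/-- The origin is a center of a quasi-homogeneous system without invariant weighted rays if and
only if the logarithmic radius has mean zero over a turn. -/
theorem isCenter_iff_integral_eq_zero (h : IsQuasiHomogeneous s₁ s₂ e P Q) {F G : ℝ → ℝ}
    (hF : ∀ t, F t = Real.cos t * P (Real.cos t) (Real.sin t)
      + Real.sin t * Q (Real.cos t) (Real.sin t))
    (hG : ∀ t, G t = s₁ * Real.cos t * Q (Real.cos t) (Real.sin t)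
      - s₂ * Real.sin t * P (Real.cos t) (Real.sin t))
    (hG0 : ∀ t, G t ≠ 0) :
    IsCenter P Q (0, 0) ↔ ∫ t in (0 : ℝ)..2 * Real.pi, F t / G t = 0 := by
  have hs₁ : (0 : ℝ) < s₁ := Nat.cast_pos.2 h.pos_left
  have hs₂ : (0 : ℝ) < s₂ := Nat.cast_pos.2 h.pos_right
  have hcs : Continuous fun t : ℝ => (Real.cos t, Real.sin t) := by fun_prop
  have hP : Continuous fun t : ℝ => P (Real.cos t) (Real.sin t) :=
    h.contDiff.continuous.fst.comp hcs
  have hQ : Continuous fun t : ℝ => Q (Real.cos t) (Real.sin t) :=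
    h.contDiff.continuous.snd.comp hcs
  have hFc : Continuous F := by
    rw [funext hF]
    exact (Real.continuous_cos.mul hP).add (Real.continuous_sin.mul hQ)
  have hGc : Continuous G := by
    rw [funext hG]
    exact ((continuous_const.mul Real.continuous_cos).mul hQ).sub
      ((continuous_const.mul Real.continuous_sin).mul hP)
  have hFp : Function.Periodic F (2 * Real.pi) := fun t => by
    simp only [hF, Real.cos_add_two_pi, Real.sin_add_two_pi]
  have hGp : Function.Periodic G (2 * Real.pi) := fun t => by
    simp only [hG, Real.cos_add_two_pi, Real.sin_add_two_pi]
  have hρc : Continuous fun t => F t / G t := hFc.div hGc hG0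
  have hρp : Function.Periodic (fun t => F t / G t) (2 * Real.pi) := fun t => by
    simp only [hFp t, hGp t]
  have hρi : ∀ a b, IntervalIntegrable (fun t => F t / G t) MeasureTheory.volume a b :=
    fun a b => hρc.intervalIntegrable a b
  have hw : ∀ t, 0 < s₁ * Real.cos t ^ 2 + s₂ * Real.sin t ^ 2 := by
    intro t
    rcases eq_or_ne (Real.cos t) 0 with h1 | h1
    · have : Real.sin t ≠ 0 := fun h2 => by
        have := Real.cos_sq_add_sin_sq t
        rw [h1, h2] at this
        norm_num at this
      positivity
    · positivity
  set A : ℝ → ℝ := fun t => ∫ u in (0 : ℝ)..t, F u / G u with hA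
  have hAd : ∀ t, HasDerivAt A (F t / G t) t := hasDerivAt_primitive hρc 0
  have hAc : Continuous A := continuous_iff_continuousAt.2 fun t => (hAd t).continuousAt
  set c : ℝ → ℝ → ℝ × ℝ := fun b t =>
    (Real.exp (b + A t) ^ s₁ * Real.cos t, Real.exp (b + A t) ^ s₂ * Real.sin t) with hc
  set m : ℝ → ℝ → ℝ := fun b t =>
    (s₁ * Real.cos t ^ 2 + s₂ * Real.sin t ^ 2) / (G t * Real.exp (b + A t) ^ e) with hm
  have hmc : ∀ b, Continuous (m b) := fun b => by
    refine Continuous.div (by fun_prop) (by fun_prop) fun t => ?_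
    have := hG0 t
    positivity
  have hcd : ∀ b t, HasDerivAt (c b)
      (m b t • (P (c b t).1 (c b t).2, Q (c b t).1 (c b t).2)) t := by
    intro b t
    have hB : HasDerivAt (fun t => b + A t) (F t / G t) t := (hAd t).const_add b
    have d1 := hasDerivAt_exp_pow_mul s₁ hB (Real.hasDerivAt_cos t)
    have d2 := hasDerivAt_exp_pow_mul s₂ hB (Real.hasDerivAt_sin t)
    have hE : Real.exp (b + A t) ≠ 0 := (Real.exp_pos _).ne'
    have hGt := hG0 t
    refine (d1.prodMk d2).congr_deriv (Prod.ext ?_ ?_)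
    · simp only [hc, hm, Prod.smul_mk, smul_eq_mul, h.map_fst, pow_add]
      field_simp
      rw [hF, hG]
      ring
    · simp only [hc, hm, Prod.smul_mk, smul_eq_mul, h.map_snd, pow_add]
      field_simp
      rw [hF, hG]
      ring
  have hcne : ∀ b t, c b t ≠ (0, 0) := by
    intro b t ht
    have hx : Real.exp (b + A t) ^ s₁ * Real.cos t = 0 := congrArg Prod.fst ht
    have hy : Real.exp (b + A t) ^ s₂ * Real.sin t = 0 := congrArg Prod.snd ht
    have hx := (mul_eq_zero.1 hx).resolve_left (by positivity)
    have hy := (mul_eq_zero.1 hy).resolve_left (by positivity)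
    have := Real.cos_sq_add_sin_sq t
    rw [hx, hy] at this
    norm_num at this
  constructor
  · intro hcen
    by_contra hI
    have key : ∀ l : Filter ℝ, l.NeBot → Tendsto A l atBot → False := by
      intro l _ hl
      refine not_isCenter_of_mem_closure h.contDiff (hmc 0) (hcd 0) ?_ (hcne 0) hcen
      have hl' : Tendsto (fun t => 0 + A t) l atBot := by simpa using hl
      refine mem_closure_of_tendsto (f := c 0) (b := l) ?_
        (Eventually.of_forall fun t => mem_range_self t)
      refine Tendsto.prodMk_nhds ?_ ?_
      · simpa using tendsto_exp_pow_mul h.pos_left hl' Real.abs_cos_le_one 1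
      · simpa using tendsto_exp_pow_mul h.pos_right hl' Real.abs_sin_le_one 1
    rcases lt_or_gt_of_ne hI with hneg | hpos
    · have hp' : Function.Periodic (fun t => -(F t / G t)) (2 * Real.pi) := fun t => by
        simp only [hFp t, hGp t]
      have := hp'.tendsto_atTop_intervalIntegral_of_pos (by simpa using hneg) Real.two_pi_pos
      simp only [intervalIntegral.integral_neg] at this
      exact key atTop inferInstance (tendsto_neg_atTop_iff.1 this)
    · exact key atBot inferInstance
        (hρp.tendsto_atBot_intervalIntegral_of_pos hpos Real.two_pi_pos)
  · intro hI
    have hAp : Function.Periodic A (2 * Real.pi) := fun t => by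
      have := hρp.intervalIntegral_add_eq_add 0 t hρi
      rw [zero_add, hI, add_zero] at this
      exact this
    refine ⟨h.apply_zero_fst, h.apply_zero_snd, univ, univ_mem, fun q _ hq => ?_⟩
    obtain ⟨b, θ, rfl⟩ := exists_weighted_polar h.pos_left h.pos_right hq
    have hcθ : c (b - A θ) θ
        = (Real.exp b ^ s₁ * Real.cos θ, Real.exp b ^ s₂ * Real.sin θ) := by
      simp [hc]
    rw [← hcθ]
    refine onPeriodicOrbit_of_closed_curve Real.two_pi_pos (hmc _) (fun t => ?_) (hcd _)
      (fun t => ?_) (fun t => ?_) ⟨θ + Real.pi, fun heq => ?_⟩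
    · have := hG0 t
      have := hw t
      simp only [hm]
      positivity
    · simp only [hc, hAp t, Real.cos_add_two_pi, Real.sin_add_two_pi]
    · simp only [hm, hAp t, hGp t, Real.cos_add_two_pi, Real.sin_add_two_pi]
    · have hx : Real.exp (b - A θ + A (θ + Real.pi)) ^ s₁ * Real.cos (θ + Real.pi)
          = Real.exp (b - A θ + A θ) ^ s₁ * Real.cos θ := congrArg Prod.fst heq
      have hy : Real.exp (b - A θ + A (θ + Real.pi)) ^ s₂ * Real.sin (θ + Real.pi)
          = Real.exp (b - A θ + A θ) ^ s₂ * Real.sin θ := congrArg Prod.snd heq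
      rw [Real.cos_add_pi] at hx
      rw [Real.sin_add_pi] at hy
      have aux : ∀ a b z : ℝ, 0 < a → 0 < b → a * -z = b * z → z = 0 := by
        intro a b z ha hb hz
        exact (mul_eq_zero.1 (show (a + b) * z = 0 by linarith)).resolve_left (by linarith)
      have hx := aux _ _ _ (by positivity) (by positivity) hx
      have hy := aux _ _ _ (by positivity) (by positivity) hy
      have := Real.cos_sq_add_sin_sq θ
      rw [hx, hy] at this
      norm_num at this

end IsQuasiHomogeneous

/-! ### Integrals of periodic functions over a turn -/

theorem Function.Periodic.integral_comp_sub_left {g : ℝ → ℝ} {T : ℝ} (hg : Function.Periodic g T)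
    (a : ℝ) : ∫ t in (0 : ℝ)..T, g (a - t) = ∫ t in (0 : ℝ)..T, g t := by
  rw [intervalIntegral.integral_comp_sub_left, sub_zero]
  simpa using hg.intervalIntegral_add_eq (a - T) 0

theorem Function.Periodic.integral_comp_add_right {g : ℝ → ℝ} {T : ℝ}
    (hg : Function.Periodic g T) (a : ℝ) :
    ∫ t in (0 : ℝ)..T, g (t + a) = ∫ t in (0 : ℝ)..T, g t := by
  rw [intervalIntegral.integral_comp_add_right, zero_add, add_comm T a]
  simpa using hg.intervalIntegral_add_eq a 0

/-! ### The systems `x' = a x ^ (k + 1) + b y`, `y' = c x ^ (2 k + 1) + d x ^ k y` -/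

section PowerSystem

variable (k : ℕ) (a b c d : ℝ)

theorem isQuasiHomogeneous_powerSystem :
    IsQuasiHomogeneous 1 (k + 1) k (fun x y => a * x ^ (k + 1) + b * y)
      (fun x y => c * x ^ (2 * k + 1) + d * x ^ k * y) where
  contDiff := by fun_prop
  pos_left := one_pos
  pos_right := k.succ_pos
  map_fst l x y := by ring
  map_snd l x y := by ring

variable {k a b c d}

theorem disc_neg_of_isCenter_powerSystem
    (h : IsCenter (fun x y => a * x ^ (k + 1) + b * y)
      (fun x y => c * x ^ (2 * k + 1) + d * x ^ k * y) (0, 0)) :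
    ((k + 1) * a + d) ^ 2 + 4 * (k + 1) * (c * b - d * a) < 0 := by
  by_contra! hd
  have hq := isQuasiHomogeneous_powerSystem k a b c d
  have hk : (0 : ℝ) < k + 1 := by positivity
  by_cases hb : b = 0
  · refine hq.not_isCenter_of_ray (x := 0) (y := 1) (by simp) ?_ h
    simp [hb]
  · set r := √(((k + 1) * a + d) ^ 2 + 4 * (k + 1) * (c * b - d * a)) with hr
    have hr2 : r ^ 2 = _ := Real.sq_sqrt hd
    refine hq.not_isCenter_of_ray (x := 1) (y := (d - (k + 1) * a + r) / (2 * (k + 1) * b))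
      (by simp) ?_ h
    simp only [one_pow]
    push_cast
    field_simp
    linear_combination (-1 : ℝ) * hr2

theorem angular_powerSystem_pos (hd : ((k + 1) * a + d) ^ 2 + 4 * (k + 1) * (c * b - d * a) < 0)
    {x y : ℝ} (hxy : x ^ 2 + y ^ 2 = 1) :
    0 < c * (x * (c * x ^ (2 * k + 1) + d * x ^ k * y)
      - (k + 1) * y * (a * x ^ (k + 1) + b * y)) := by
  have key : 4 * (c * (x * (c * x ^ (2 * k + 1) + d * x ^ k * y)
      - (k + 1) * y * (a * x ^ (k + 1) + b * y)))
      = (2 * c * x ^ (k + 1) + (d - (k + 1) * a) * y) ^ 2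
        - (((k + 1) * a + d) ^ 2 + 4 * (k + 1) * (c * b - d * a)) * y ^ 2 := by ring
  rcases eq_or_ne y 0 with rfl | hy
  · have hc : c ≠ 0 := by
      rintro rfl
      nlinarith [sq_nonneg ((k + 1) * a - d)]
    have hx : x ≠ 0 := by
      rintro rfl
      norm_num at hxy
    have : 0 < (2 * c * x ^ (k + 1)) ^ 2 := by positivity
    simp only [mul_zero, add_zero] at key
    simp only [mul_zero, add_zero]
    nlinarith
  · have hy2 : 0 < y ^ 2 := by positivity
    nlinarith [sq_nonneg (2 * c * x ^ (k + 1) + (d - (k + 1) * a) * y),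
      mul_pos_of_neg_of_neg hd (neg_neg_of_pos hy2)]

theorem isCenter_powerSystem_iff_of_odd (hk : Odd k) :
    IsCenter (fun x y => a * x ^ (k + 1) + b * y)
      (fun x y => c * x ^ (2 * k + 1) + d * x ^ k * y) (0, 0) ↔
    ((k + 1) * a + d) ^ 2 + 4 * (k + 1) * (c * b - d * a) < 0 := by
  refine ⟨disc_neg_of_isCenter_powerSystem, fun hd => ?_⟩
  set F : ℝ → ℝ := fun t => Real.cos t * (a * Real.cos t ^ (k + 1) + b * Real.sin t)
    + Real.sin t * (c * Real.cos t ^ (2 * k + 1) + d * Real.cos t ^ k * Real.sin t) with hF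
  set G : ℝ → ℝ := fun t =>
    Real.cos t * (c * Real.cos t ^ (2 * k + 1) + d * Real.cos t ^ k * Real.sin t)
      - (k + 1) * Real.sin t * (a * Real.cos t ^ (k + 1) + b * Real.sin t) with hG
  have hG0 : ∀ t, G t ≠ 0 := fun t =>
    right_ne_zero_of_mul (angular_powerSystem_pos hd (Real.cos_sq_add_sin_sq t)).ne'
  refine ((isQuasiHomogeneous_powerSystem k a b c d).isCenter_iff_integral_eq_zero (F := F)
    (G := G) (fun t => rfl) (fun t => by simp [hG]) hG0).2 ?_
  have hper : Function.Periodic (fun t => F t / G t) (2 * Real.pi) := fun t => by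
    simp only [hF, hG, Real.cos_add_two_pi, Real.sin_add_two_pi]
  have h1 := hper.integral_comp_sub_left Real.pi
  have h2 : ∀ t, F (Real.pi - t) / G (Real.pi - t) = -(F t / G t) := by
    intro t
    have e1 : (-Real.cos t) ^ k = -Real.cos t ^ k := hk.neg_pow _
    have eF : F (Real.pi - t) = -F t := by
      simp only [hF, Real.cos_pi_sub, Real.sin_pi_sub, pow_succ, two_mul, pow_add, e1]
      ring
    have eG : G (Real.pi - t) = G t := by
      simp only [hG, Real.cos_pi_sub, Real.sin_pi_sub, pow_succ, two_mul, pow_add, e1]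
      ring
    rw [eF, eG, neg_div]
  simp only [h2, intervalIntegral.integral_neg] at h1
  linarith

theorem isCenter_powerSystem_iff_of_even (hk : Even k) :
    IsCenter (fun x y => a * x ^ (k + 1) + b * y)
      (fun x y => c * x ^ (2 * k + 1) + d * x ^ k * y) (0, 0) ↔
    ((k + 1) * a + d) ^ 2 + 4 * (k + 1) * (c * b - d * a) < 0 ∧ (k + 1) * a + d = 0 := by
  suffices key : ((k + 1) * a + d) ^ 2 + 4 * (k + 1) * (c * b - d * a) < 0 →
      (IsCenter (fun x y => a * x ^ (k + 1) + b * y)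
        (fun x y => c * x ^ (2 * k + 1) + d * x ^ k * y) (0, 0) ↔ (k + 1) * a + d = 0) from
    ⟨fun h => have hd := disc_neg_of_isCenter_powerSystem h
      ⟨hd, (key hd).1 h⟩, fun h => (key h.1).2 h.2⟩
  intro hd
  set F : ℝ → ℝ := fun t => Real.cos t * (a * Real.cos t ^ (k + 1) + b * Real.sin t)
    + Real.sin t * (c * Real.cos t ^ (2 * k + 1) + d * Real.cos t ^ k * Real.sin t) with hF
  set G : ℝ → ℝ := fun t =>
    Real.cos t * (c * Real.cos t ^ (2 * k + 1) + d * Real.cos t ^ k * Real.sin t)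
      - (k + 1) * Real.sin t * (a * Real.cos t ^ (k + 1) + b * Real.sin t) with hG
  set W : ℝ → ℝ := fun t => (Real.cos t ^ 2 + (k + 1) * Real.sin t ^ 2) * Real.cos t ^ k with hW
  have hcG : ∀ t, 0 < c * G t := fun t => angular_powerSystem_pos hd (Real.cos_sq_add_sin_sq t)
  have hG0 : ∀ t, G t ≠ 0 := fun t => right_ne_zero_of_mul (hcG t).ne'
  rw [(isQuasiHomogeneous_powerSystem k a b c d).isCenter_iff_integral_eq_zero (F := F)
    (G := G) (fun t => rfl) (fun t => by simp [hG]) hG0]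
  have hFc : Continuous F := by fun_prop
  have hGc : Continuous G := by fun_prop
  have hWc : Continuous W := by fun_prop
  set G' : ℝ → ℝ := fun t => ((k + 1) * a + d) * W t - 2 * (k + 1) * F t with hG'
  have hGd : ∀ t, HasDerivAt G (G' t) t := by
    intro t
    have e : G = fun t => c * Real.cos t ^ (2 * k + 2)
        + (d - (k + 1) * a) * (Real.cos t ^ (k + 1) * Real.sin t)
        - (k + 1) * b * Real.sin t ^ 2 := by
      funext t
      simp only [hG]
      ring
    rw [e]
    have hc := Real.hasDerivAt_cos t
    have hs := Real.hasDerivAt_sin t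
    refine ((((hc.pow (2 * k + 2)).const_mul c).add
      (((hc.pow (k + 1)).mul hs).const_mul (d - (k + 1) * a))).sub
      ((hs.pow 2).const_mul ((k + 1) * b))).congr_deriv ?_
    simp only [hG', hF, hW, Pi.pow_apply, Nat.add_sub_cancel, show 2 * k + 2 - 1 = 2 * k + 1 from rfl]
    push_cast
    ring
  have hlog : ∫ t in (0 : ℝ)..2 * Real.pi, G' t / G t = 0 := by
    rw [intervalIntegral.integral_eq_sub_of_hasDerivAt (f := fun t => Real.log (G t))
      (fun t _ => (hGd t).log (hG0 t))
      (Continuous.intervalIntegrable ((by fun_prop : Continuous G').div hGc hG0) _ _)]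
    simp [hG]
  have hpos : 0 < ∫ t in (0 : ℝ)..2 * Real.pi, c * (W t / G t) := by
    refine intervalIntegral.integral_pos Real.two_pi_pos
      ((continuous_const.mul (hWc.div hGc hG0)).continuousOn) (fun t _ => ?_)
      ⟨0, ⟨le_rfl, Real.two_pi_pos.le⟩, ?_⟩
    · have hWt : 0 ≤ W t := mul_nonneg (by positivity) (hk.pow_nonneg _)
      have : c * (W t / G t) = W t * (c * G t) / G t ^ 2 := by
        have := hG0 t
        field_simp
      rw [this]
      exact div_nonneg (mul_nonneg hWt (hcG t).le) (sq_nonneg _)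
    · have h0 : c ≠ 0 := left_ne_zero_of_mul (hcG 0).ne'
      simp [hW, hG, h0]
  have hsplit : ∀ t, G' t / G t = ((k + 1) * a + d) * (W t / G t)
      - 2 * (k + 1) * (F t / G t) := fun t => by
    simp only [hG']
    ring
  simp only [hsplit] at hlog
  have hWG : Continuous fun t => W t / G t := hWc.div hGc hG0
  have hFG : Continuous fun t => F t / G t := hFc.div hGc hG0
  rw [intervalIntegral.integral_sub ((hWG.intervalIntegrable _ _).const_mul _)
    ((hFG.intervalIntegrable _ _).const_mul _),
    intervalIntegral.integral_const_mul, intervalIntegral.integral_const_mul] at hlog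
  rw [intervalIntegral.integral_const_mul] at hpos
  have hk0 : (0 : ℝ) < k + 1 := by positivity
  have hWI := right_ne_zero_of_mul hpos.ne'
  constructor
  · intro hI
    rw [hI, mul_zero, sub_zero] at hlog
    exact (mul_eq_zero.1 hlog).resolve_right hWI
  · intro ht
    rw [ht, zero_mul, zero_sub, neg_eq_zero] at hlog
    exact (mul_eq_zero.1 hlog).resolve_left (by positivity)

theorem mul_ne_zero_of_disc_neg (hd : ((k + 1) * a + d) ^ 2 + 4 * (k + 1) * (c * b - d * a) < 0) :
    b * c ≠ 0 := by
  intro h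
  nlinarith [sq_nonneg ((k + 1) * a - d)]

end PowerSystem

/-! ### Homogeneous cubic systems without invariant lines -/

section CubicSystem

theorem isQuasiHomogeneous_cubicSystem (a b c d a' b' c' d' : ℝ) :
    IsQuasiHomogeneous 1 1 2
      (fun x y => a * x ^ 3 + b * x ^ 2 * y + c * x * y ^ 2 + d * y ^ 3)
      (fun x y => a' * x ^ 3 + b' * x ^ 2 * y + c' * x * y ^ 2 + d' * y ^ 3) where
  contDiff := by fun_prop
  pos_left := one_pos
  pos_right := one_pos
  map_fst l x y := by ring
  map_snd l x y := by ring

theorem quartic_pos {μ x y : ℝ} (hμ : -1 / 3 < μ) (hxy : x ^ 2 + y ^ 2 = 1) :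
    0 < x ^ 4 + 6 * μ * x ^ 2 * y ^ 2 + y ^ 4 := by
  have e : x ^ 4 + 6 * μ * x ^ 2 * y ^ 2 + y ^ 4
      = (x ^ 2 - y ^ 2) ^ 2 + 2 * (3 * μ + 1) * (x * y) ^ 2 := by ring
  have hμ' : 0 < 3 * μ + 1 := by linarith
  rcases eq_or_ne (x * y) 0 with h | h
  · have h2 : (x ^ 2 - y ^ 2) ^ 2 = 1 := by
      linear_combination (x ^ 2 + y ^ 2 + 1) * hxy - 4 * (x * y) * h
    rw [e, h2, h]
    norm_num
  · rw [e]
    positivity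

theorem isCenter_cubicSystem_iff {p1 p2 p3 α μ : ℝ} (hα : α = 1 ∨ α = -1) (hμ : -1 / 3 < μ)
    (q : ℝ × ℝ) :
    IsCenter
      (fun x y => p1 * x ^ 3 + (p2 - 3 * α * μ) * x ^ 2 * y + p3 * x * y ^ 2 - α * y ^ 3)
      (fun x y => α * x ^ 3 + p1 * x ^ 2 * y + (p2 + 3 * α * μ) * x * y ^ 2 + p3 * y ^ 3) q ↔
    q = (0, 0) ∧ p3 = -p1 := by
  have hq : IsQuasiHomogeneous 1 1 2
      (fun x y => p1 * x ^ 3 + (p2 - 3 * α * μ) * x ^ 2 * y + p3 * x * y ^ 2 - α * y ^ 3)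
      (fun x y => α * x ^ 3 + p1 * x ^ 2 * y + (p2 + 3 * α * μ) * x * y ^ 2 + p3 * y ^ 3) := by
    simpa [← sub_eq_add_neg] using isQuasiHomogeneous_cubicSystem p1 (p2 - 3 * α * μ) p3 (-α)
      α p1 (p2 + 3 * α * μ) p3
  suffices key : IsCenter
      (fun x y => p1 * x ^ 3 + (p2 - 3 * α * μ) * x ^ 2 * y + p3 * x * y ^ 2 - α * y ^ 3)
      (fun x y => α * x ^ 3 + p1 * x ^ 2 * y + (p2 + 3 * α * μ) * x * y ^ 2 + p3 * y ^ 3)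
      (0, 0) ↔ p3 = -p1 by
    constructor
    · intro h
      have h0 := hq.eq_zero_of_isCenter h
      subst h0
      exact ⟨rfl, key.1 h⟩
    · rintro ⟨rfl, h⟩
      exact key.2 h
  have hα2 : α * α = 1 := by rcases hα with rfl | rfl <;> norm_num
  have hα0 : α ≠ 0 := left_ne_zero_of_mul_eq_one hα2
  set F : ℝ → ℝ := fun t => p1 * Real.cos t ^ 2 + p3 * Real.sin t ^ 2
    + Real.cos t * Real.sin t * ((p2 - 3 * α * μ + α) * Real.cos t ^ 2
      + (p2 + 3 * α * μ - α) * Real.sin t ^ 2) with hF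
  set G : ℝ → ℝ := fun t =>
    α * (Real.cos t ^ 4 + 6 * μ * Real.cos t ^ 2 * Real.sin t ^ 2 + Real.sin t ^ 4) with hG
  have hquart := fun t => quartic_pos hμ (Real.cos_sq_add_sin_sq t)
  have hG0 : ∀ t, G t ≠ 0 := fun t => mul_ne_zero hα0 (hquart t).ne'
  have hFc : Continuous F := by fun_prop
  have hGc : Continuous G := by fun_prop
  have hρc : Continuous fun t => F t / G t := hFc.div hGc hG0
  rw [hq.isCenter_iff_integral_eq_zero (F := F) (G := G) (fun t => ?_) (fun t => ?_) hG0]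
  rotate_left
  · simp only [hF]
    linear_combination (-(p1 * Real.cos t ^ 2 + p3 * Real.sin t ^ 2))
      * Real.cos_sq_add_sin_sq t
  · simp only [hG]
    push_cast
    ring
  have hper : Function.Periodic (fun t => F t / G t) (2 * Real.pi) := fun t => by
    simp only [hF, hG, Real.cos_add_two_pi, Real.sin_add_two_pi]
  have h1 := hper.integral_comp_sub_left 0
  have h2 := hper.integral_comp_add_right (Real.pi / 2)
  have h3 := hper.integral_comp_sub_left (-(Real.pi / 2))
  have hcont : ∀ f : ℝ → ℝ, Continuous f →
      IntervalIntegrable (fun t => F (f t) / G (f t)) MeasureTheory.volume 0 (2 * Real.pi) :=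
    fun f hf => (hρc.comp hf).intervalIntegrable _ _
  have hsum : ∀ t, ((F t / G t + F (0 - t) / G (0 - t))
      + F (t + Real.pi / 2) / G (t + Real.pi / 2))
      + F (-(Real.pi / 2) - t) / G (-(Real.pi / 2) - t) = 2 * (p1 + p3) * (1 / G t) := by
    intro t
    have c3 : Real.cos (-(Real.pi / 2) - t) = -Real.sin t := by
      rw [← Real.cos_neg, neg_sub, sub_neg_eq_add, Real.cos_add_pi_div_two]
    have s3 : Real.sin (-(Real.pi / 2) - t) = -Real.cos t := by
      rw [← neg_neg (-(Real.pi / 2) - t), Real.sin_neg, neg_sub, sub_neg_eq_add,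
        Real.sin_add_pi_div_two]
    have g1 : G (0 - t) = G t := by
      simp only [hG, zero_sub, Real.cos_neg, Real.sin_neg]
      ring
    have g2 : G (t + Real.pi / 2) = G t := by
      simp only [hG, Real.cos_add_pi_div_two, Real.sin_add_pi_div_two]
      ring
    have g3 : G (-(Real.pi / 2) - t) = G t := by
      simp only [hG, c3, s3]
      ring
    rw [g1, g2, g3, ← add_div, ← add_div, ← add_div, mul_one_div]
    congr 1
    simp only [hF, c3, s3, zero_sub, Real.cos_neg, Real.sin_neg, Real.cos_add_pi_div_two,
      Real.sin_add_pi_div_two]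
    linear_combination 2 * (p1 + p3) * Real.cos_sq_add_sin_sq t
  have htot : 4 * ∫ t in (0 : ℝ)..2 * Real.pi, F t / G t
      = 2 * (p1 + p3) * ∫ t in (0 : ℝ)..2 * Real.pi, 1 / G t := by
    rw [← intervalIntegral.integral_const_mul (2 * (p1 + p3))]
    simp only [← hsum]
    have i0 := hcont (fun t => t) continuous_id
    have i1 := hcont (fun t => 0 - t) (by fun_prop)
    have i2 := hcont (fun t => t + Real.pi / 2) (by fun_prop)
    have i3 := hcont (fun t => -(Real.pi / 2) - t) (by fun_prop)
    rw [intervalIntegral.integral_add ((i0.add i1).add i2) i3,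
      intervalIntegral.integral_add (i0.add i1) i2, intervalIntegral.integral_add i0 i1,
      h1, h2, h3]
    ring
  have hpos : 0 < ∫ t in (0 : ℝ)..2 * Real.pi, α * (1 / G t) := by
    refine intervalIntegral.intervalIntegral_pos_of_pos
      ((continuous_const.mul (continuous_const.div hGc hG0)).intervalIntegrable _ _)
      (fun t => ?_) Real.two_pi_pos
    simp only [hG]
    rw [mul_one_div, div_mul_cancel_left₀ hα0]
    exact inv_pos.2 (hquart t)
  rw [intervalIntegral.integral_const_mul] at hpos
  have hI := right_ne_zero_of_mul hpos.ne'
  constructor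
  · intro h
    rw [h, mul_zero] at htot
    have := (mul_eq_zero.1 htot.symm).resolve_right hI
    linarith
  · intro h
    rw [h] at htot
    linarith

end CubicSystem

theorem theorem1 :
    -- (a) weight degree 1
    ((∀ a10 a01 b10 b01 : ℝ,
        IsCenter (fun x y => a10 * x + a01 * y) (fun x y => b10 * x + b01 * y) (0, 0) ↔
          b01 = -a10 ∧ a10 * b01 - a01 * b10 > 0) ∧
      (∀ (p : ℕ) (a10 bp0 b01 : ℝ), 1 < p →
        HasNoCenters (fun x _ => a10 * x) (fun x y => bp0 * x ^ p + b01 * y))) ∧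
    -- (b) weight degree 2
    ((∀ a20 a11 a02 b20 b11 b02 : ℝ,
        HasNoCenters (fun x y => a20 * x ^ 2 + a11 * x * y + a02 * y ^ 2)
          (fun x y => b20 * x ^ 2 + b11 * x * y + b02 * y ^ 2)) ∧
      (∀ a01 b20 : ℝ,
        HasNoCenters (fun _ y => a01 * y) (fun x _ => b20 * x ^ 2)) ∧
      (∀ a20 a01 b30 b11 : ℝ,
        IsCenter (fun x y => a20 * x ^ 2 + a01 * y)
            (fun x y => b30 * x ^ 3 + b11 * x * y) (0, 0) ↔
          a01 * b30 ≠ 0 ∧ (2 * a20 + b11) ^ 2 + 8 * (b30 * a01 - b11 * a20) < 0)) ∧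
    -- (c) weight degree 3
    ((∀ a30 a11 b40 b21 b02 : ℝ,
        HasNoCenters (fun x y => a30 * x ^ 3 + a11 * x * y)
          (fun x y => b40 * x ^ 4 + b21 * x ^ 2 * y + b02 * y ^ 2)) ∧
      (∀ p1 p2 p3 μ : ℝ, μ ≠ 0 →
        HasNoCenters
          (fun x y => p1 * x ^ 3 + p2 * x ^ 2 * y + p3 * x * y ^ 2 + μ * y ^ 3)
          (fun x y => μ * x ^ 3 + p1 * x ^ 2 * y + p2 * x * y ^ 2 + p3 * y ^ 3)) ∧
      (∀ p1 p2 p3 α : ℝ, α = 1 ∨ α = -1 →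
        HasNoCenters
          (fun x y => p1 * x ^ 3 + (p2 + 3 * α) * x ^ 2 * y + (p3 - 6 * α) * x * y ^ 2
            - 6 * α * y ^ 3)
          (fun x y => p1 * x ^ 2 * y + (p2 - 3 * α) * x * y ^ 2 + (p3 + 6 * α) * y ^ 3)) ∧
      (∀ p1 p2 p3 : ℝ,
        HasNoCenters
          (fun x y => p1 * x ^ 3 + p2 * x ^ 2 * y + (p3 + 2) * x * y ^ 2 - 4 * y ^ 3)
          (fun x y => p1 * x ^ 2 * y + p2 * x * y ^ 2 + (p3 - 2) * y ^ 3)) ∧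
      (∀ p1 p2 p3 α : ℝ, α = 1 ∨ α = -1 →
        HasNoCenters
          (fun x y => p1 * x ^ 3 + (p2 - 3 * α) * x ^ 2 * y + p3 * x * y ^ 2 - 6 * y ^ 3)
          (fun x y => p1 * x ^ 2 * y + (p2 + 3 * α) * x * y ^ 2 + p3 * y ^ 3)) ∧
      (∀ p1 p2 p3 α : ℝ, α = 1 ∨ α = -1 →
        HasNoCenters
          (fun x y => p1 * x ^ 3 + p2 * x ^ 2 * y + p3 * x * y ^ 2 - α * y ^ 3)
          (fun x y => p1 * x ^ 2 * y + p2 * x * y ^ 2 + p3 * y ^ 3)) ∧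
      (∀ p1 p2 p3 : ℝ,
        HasNoCenters
          (fun x y => x * (p1 * x ^ 2 + p2 * x * y + p3 * y ^ 2))
          (fun x y => y * (p1 * x ^ 2 + p2 * x * y + p3 * y ^ 2))) ∧
      (∀ a30 a01 b50 b21 : ℝ,
        IsCenter (fun x y => a30 * x ^ 3 + a01 * y)
            (fun x y => b50 * x ^ 5 + b21 * x ^ 2 * y) (0, 0) ↔
          a01 * b50 ≠ 0 ∧ (3 * a30 + b21) ^ 2 + 12 * (b50 * a01 - b21 * a30) < 0 ∧
            3 * a30 + b21 = 0) ∧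
      (∀ p1 p2 p3 α μ : ℝ, α = 1 ∨ α = -1 → μ > -1 / 3 → μ ≠ 1 / 3 →
        ∀ q : ℝ × ℝ,
          IsCenter
            (fun x y => p1 * x ^ 3 + (p2 - 3 * α * μ) * x ^ 2 * y + p3 * x * y ^ 2
              - α * y ^ 3)
            (fun x y => α * x ^ 3 + p1 * x ^ 2 * y + (p2 + 3 * α * μ) * x * y ^ 2
              + p3 * y ^ 3) q ↔
          q = (0, 0) ∧ p3 = -p1) ∧
      (∀ p1 p2 p3 α : ℝ, α = 1 ∨ α = -1 →
        ∀ q : ℝ × ℝ,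
          IsCenter
            (fun x y => p1 * x ^ 3 + (p2 - α) * x ^ 2 * y + p3 * x * y ^ 2 - α * y ^ 3)
            (fun x y => α * x ^ 3 + p1 * x ^ 2 * y + (p2 + α) * x * y ^ 2 + p3 * y ^ 3) q ↔
          q = (0, 0) ∧ p3 = -p1)) ∧
    -- (d) weight degree 4
    ((∀ a40 a31 a22 a13 a04 b40 b31 b22 b13 b04 : ℝ,
        HasNoCenters
          (fun x y => a40 * x ^ 4 + a31 * x ^ 3 * y + a22 * x ^ 2 * y ^ 2 + a13 * x * y ^ 3
            + a04 * y ^ 4)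
          (fun x y => b40 * x ^ 4 + b31 * x ^ 3 * y + b22 * x ^ 2 * y ^ 2 + b13 * x * y ^ 3
            + b04 * y ^ 4)) ∧
      (∀ a40 a21 a02 b50 b31 b12 : ℝ,
        HasNoCenters (fun x y => a40 * x ^ 4 + a21 * x ^ 2 * y + a02 * y ^ 2)
          (fun x y => b50 * x ^ 5 + b31 * x ^ 3 * y + b12 * x * y ^ 2)) ∧
      (∀ a40 a11 b60 b31 b02 : ℝ,
        HasNoCenters (fun x y => a40 * x ^ 4 + a11 * x * y)
          (fun x y => b60 * x ^ 6 + b31 * x ^ 3 * y + b02 * y ^ 2)) ∧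
      (∀ a11 b30 b02 : ℝ,
        HasNoCenters (fun x y => a11 * x * y) (fun x y => b30 * x ^ 3 + b02 * y ^ 2)) ∧
      (∀ a01 b40 : ℝ,
        HasNoCenters (fun _ y => a01 * y) (fun x _ => b40 * x ^ 4)) ∧
      (∀ a40 a01 b70 b31 : ℝ,
        IsCenter (fun x y => a40 * x ^ 4 + a01 * y)
            (fun x y => b70 * x ^ 7 + b31 * x ^ 3 * y) (0, 0) ↔
          a01 * b70 ≠ 0 ∧ (4 * a40 + b31) ^ 2 + 16 * (b70 * a01 - b31 * a40) < 0)) := by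
  refine ⟨⟨?_, ?_⟩, ⟨?_, ?_, ?_⟩, ⟨?_, ?_, ?_, ?_, ?_, ?_, ?_, ?_, ?_, ?_⟩, ?_, ?_, ?_, ?_, ?_, ?_⟩
  · intro a10 a01 b10 b01
    have h := isCenter_powerSystem_iff_of_even (k := 0) (a := a10) (b := a01) (c := b10)
      (d := b01) Even.zero
    simp only [mul_zero, zero_add, pow_one, pow_zero, mul_one, Nat.cast_zero, one_mul] at h
    rw [h]
    constructor
    · rintro ⟨h1, h2⟩
      rw [h2] at h1
      exact ⟨by linarith, by linarith⟩
    · rintro ⟨h1, h2⟩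
      have h3 : a10 + b01 = 0 := by linarith
      refine ⟨?_, h3⟩
      rw [h3]
      linarith
  · intro p a10 bp0 b01 hp
    have hq : IsQuasiHomogeneous 1 p 0 (fun x _ => a10 * x)
        (fun x y => bp0 * x ^ p + b01 * y) :=
      ⟨by fun_prop, one_pos, by omega, fun l x y => by ring, fun l x y => by ring⟩
    exact hq.hasNoCenters_of_ray (x := 0) (y := 1) (by simp) (by simp)
  · intro a20 a11 a02 b20 b11 b02
    have hq : IsQuasiHomogeneous 1 1 1 (fun x y => a20 * x ^ 2 + a11 * x * y + a02 * y ^ 2)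
        (fun x y => b20 * x ^ 2 + b11 * x * y + b02 * y ^ 2) :=
      ⟨by fun_prop, one_pos, one_pos, fun l x y => by ring, fun l x y => by ring⟩
    refine hq.hasNoCenters_of_antipodal 0 ?_
    ring
  · intro a01 b20
    have hq : IsQuasiHomogeneous 2 3 1 (fun _ y => a01 * y) (fun x _ => b20 * x ^ 2) :=
      ⟨by fun_prop, two_pos, three_pos, fun l x y => by ring, fun l x y => by ring⟩
    refine hq.hasNoCenters_of_antipodal 0 ?_
    simp
  · intro a20 a01 b30 b11
    have h := isCenter_powerSystem_iff_of_odd (k := 1) (a := a20) (b := a01) (c := b30)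
      (d := b11) odd_one
    have hne := mul_ne_zero_of_disc_neg (k := 1) (a := a20) (b := a01) (c := b30) (d := b11)
    norm_num at h hne
    rw [h]
    exact ⟨fun hd => ⟨by simpa using hne hd, hd⟩, fun hd => hd.2⟩
  · intro a30 a11 b40 b21 b02
    have hq : IsQuasiHomogeneous 1 2 2 (fun x y => a30 * x ^ 3 + a11 * x * y)
        (fun x y => b40 * x ^ 4 + b21 * x ^ 2 * y + b02 * y ^ 2) :=
      ⟨by fun_prop, one_pos, two_pos, fun l x y => by ring, fun l x y => by ring⟩
    exact hq.hasNoCenters_of_ray (x := 0) (y := 1) (by simp) (by simp)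
  · intro p1 p2 p3 μ _
    exact (isQuasiHomogeneous_cubicSystem p1 p2 p3 μ μ p1 p2 p3).hasNoCenters_of_ray
      (x := 1) (y := 1) (by simp) (by ring)
  · intro p1 p2 p3 α _
    have hq := isQuasiHomogeneous_cubicSystem p1 (p2 + 3 * α) (p3 - 6 * α) (-(6 * α))
      0 p1 (p2 - 3 * α) (p3 + 6 * α)
    simp only [neg_mul, ← sub_eq_add_neg, zero_mul, zero_add] at hq
    exact hq.hasNoCenters_of_ray (x := 1) (y := 0) (by simp) (by simp)
  · intro p1 p2 p3
    have hq := isQuasiHomogeneous_cubicSystem p1 p2 (p3 + 2) (-4) 0 p1 p2 (p3 - 2)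
    simp only [neg_mul, ← sub_eq_add_neg, zero_mul, zero_add] at hq
    exact hq.hasNoCenters_of_ray (x := 1) (y := 0) (by simp) (by simp)
  · intro p1 p2 p3 α _
    have hq := isQuasiHomogeneous_cubicSystem p1 (p2 - 3 * α) p3 (-6) 0 p1 (p2 + 3 * α) p3
    simp only [neg_mul, ← sub_eq_add_neg, zero_mul, zero_add] at hq
    exact hq.hasNoCenters_of_ray (x := 1) (y := 0) (by simp) (by simp)
  · intro p1 p2 p3 α _
    have hq := isQuasiHomogeneous_cubicSystem p1 p2 p3 (-α) 0 p1 p2 p3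
    simp only [neg_mul, ← sub_eq_add_neg, zero_mul, zero_add] at hq
    exact hq.hasNoCenters_of_ray (x := 1) (y := 0) (by simp) (by simp)
  · intro p1 p2 p3
    have hq : IsQuasiHomogeneous 1 1 2
        (fun x y => x * (p1 * x ^ 2 + p2 * x * y + p3 * y ^ 2))
        (fun x y => y * (p1 * x ^ 2 + p2 * x * y + p3 * y ^ 2)) :=
      ⟨by fun_prop, one_pos, one_pos, fun l x y => by ring, fun l x y => by ring⟩
    exact hq.hasNoCenters_of_ray (x := 1) (y := 0) (by simp) (by simp)
  · intro a30 a01 b50 b21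
    have h := isCenter_powerSystem_iff_of_even (k := 2) (a := a30) (b := a01) (c := b50)
      (d := b21) even_two
    have hne := mul_ne_zero_of_disc_neg (k := 2) (a := a30) (b := a01) (c := b50) (d := b21)
    norm_num at h hne
    rw [h]
    exact ⟨fun hd => ⟨by simpa using hne hd.1, hd⟩, fun hd => hd.2⟩
  · intro p1 p2 p3 α μ hα hμ _ q
    exact isCenter_cubicSystem_iff hα hμ q
  · intro p1 p2 p3 α hα q
    have h := isCenter_cubicSystem_iff (p1 := p1) (p2 := p2) (p3 := p3) (μ := 1 / 3) hα
      (by norm_num) q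
    rwa [show 3 * α * (1 / 3) = α by ring] at h
  · intro a40 a31 a22 a13 a04 b40 b31 b22 b13 b04
    have hq : IsQuasiHomogeneous 1 1 3
        (fun x y => a40 * x ^ 4 + a31 * x ^ 3 * y + a22 * x ^ 2 * y ^ 2 + a13 * x * y ^ 3
          + a04 * y ^ 4)
        (fun x y => b40 * x ^ 4 + b31 * x ^ 3 * y + b22 * x ^ 2 * y ^ 2 + b13 * x * y ^ 3
          + b04 * y ^ 4) :=
      ⟨by fun_prop, one_pos, one_pos, fun l x y => by ring, fun l x y => by ring⟩
    refine hq.hasNoCenters_of_antipodal 0 ?_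
    ring
  · intro a40 a21 a02 b50 b31 b12
    have hq : IsQuasiHomogeneous 1 2 3 (fun x y => a40 * x ^ 4 + a21 * x ^ 2 * y + a02 * y ^ 2)
        (fun x y => b50 * x ^ 5 + b31 * x ^ 3 * y + b12 * x * y ^ 2) :=
      ⟨by fun_prop, one_pos, two_pos, fun l x y => by ring, fun l x y => by ring⟩
    refine hq.hasNoCenters_of_antipodal (Real.pi / 2) ?_
    simp
  · intro a40 a11 b60 b31 b02
    have hq : IsQuasiHomogeneous 1 3 3 (fun x y => a40 * x ^ 4 + a11 * x * y)
        (fun x y => b60 * x ^ 6 + b31 * x ^ 3 * y + b02 * y ^ 2) :=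
      ⟨by fun_prop, one_pos, three_pos, fun l x y => by ring, fun l x y => by ring⟩
    exact hq.hasNoCenters_of_ray (x := 0) (y := 1) (by simp) (by simp)
  · intro a11 b30 b02
    have hq : IsQuasiHomogeneous 2 3 3 (fun x y => a11 * x * y)
        (fun x y => b30 * x ^ 3 + b02 * y ^ 2) :=
      ⟨by fun_prop, two_pos, three_pos, fun l x y => by ring, fun l x y => by ring⟩
    exact hq.hasNoCenters_of_ray (x := 0) (y := 1) (by simp) (by simp)
  · intro a01 b40
    have hq : IsQuasiHomogeneous 2 5 3 (fun _ y => a01 * y) (fun x _ => b40 * x ^ 4) :=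
      ⟨by fun_prop, two_pos, by norm_num, fun l x y => by ring, fun l x y => by ring⟩
    refine hq.hasNoCenters_of_antipodal 0 ?_
    norm_num
  · intro a40 a01 b70 b31
    have h := isCenter_powerSystem_iff_of_odd (k := 3) (a := a40) (b := a01) (c := b70)
      (d := b31) (by decide)
    have hne := mul_ne_zero_of_disc_neg (k := 3) (a := a40) (b := a01) (c := b70) (d := b31)
    norm_num at h hne
    rw [h]
    exact ⟨fun hd => ⟨by simpa using hne hd, hd⟩, fun hd => hd.2⟩
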